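/- All groups are finite and $p$ is a prime. A chief factor of a group $G$ is a quotient $H/K$ where $K<H$ are normal subgroups of $G$ with no normal subgroup of $G$ strictly between them. The group $G$ is $p$-solvable if each of its chief factors is a $p$-group or a $p'$-group (a group of order prime to $p$), and $p$-supersolvable if each of its chief factors has order $p$ or is a $p'$-group; $\mathscr{U}_p$ is the class of $p$-supersolvable groups. The $\mathscr{U}_p$-residual $G^{\mathscr{U}_p}$ is the intersection of all normal subgroups $N$ of $G$ with $G/N\in\mathscr{U}_p$, and $$N_{\mathscr{U}_p}(G)=\bigcap_{T\le G}N_G\bigl(T^{\mathscr{U}_p}\bigr).$$ A group is $p$-nilpotent if it has a normal $p'$-subgroup of $p$-power index. The $p$-Fitting subgroup $F_p(G)$ is the largest normal $p$-nilpotent subgroup of $G$. Put $F_p^0(G)=1$ and $F_p^{i+1}(G)/F_p^i(G)=F_p(G/F_p^i(G))$. The $p$-Fitting length $h_p(G)$ of a $p$-solvable group $G$ is the smallest positive integer $n$ with $F_p^n(G)=G$. **Theorem 4.10.** Let $G$ be a $p$-solvable group with $G=N_{\mathscr{U}_p}(G)$. Then 1. $G^{\mathscr{U}_p}$ is a $p$-group;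 2. $N_{\mathscr{U}_p}(G/N)\neq 1$ for every proper normal subgroup $N$ of $G$; 3. $h_p(G)\le 3$. -/

import Mathlib

universe u

/-- `H / K` is a chief factor of `G`: `K < H` are normal subgroups of `G` and no normal subgroup
of `G` lies strictly between them. The order of `H / K` is `K.relIndex H`. -/
def IsChiefFactor {G : Type u} [Group G] (K H : Subgroup G) : Prop :=
  K.Normal ∧ H.Normal ∧ K < H ∧
    ∀ L : Subgroup G, L.Normal → K ≤ L → L ≤ H → L = K ∨ L = H

/-- A finite group is `p`-solvable if each of its chief factors is a `p`-group or a
`p'`-group. -/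
def IsPSolvable (p : ℕ) (G : Type u) [Group G] : Prop :=
  ∀ K H : Subgroup G, IsChiefFactor K H →
    (∃ k : ℕ, K.relIndex H = p ^ k) ∨ ¬ p ∣ K.relIndex H

/-- A finite group is `p`-supersolvable if each of its chief factors has order `p` or is a
`p'`-group. -/
def IsPSupersolvable (p : ℕ) (G : Type u) [Group G] : Prop :=
  ∀ K H : Subgroup G, IsChiefFactor K H → K.relIndex H = p ∨ ¬ p ∣ K.relIndex H

/-- The `p`-supersolvable residual of `G`: the intersection of all normal subgroups with
`p`-supersolvable quotient. -/
def pSupersolvableResidual (p : ℕ) (G : Type u) [Group G] : Subgroup G :=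
  sInf {N : Subgroup G | ∃ _ : N.Normal, IsPSupersolvable p (G ⧸ N)}

/-- The norm of `G` with respect to `p`-supersolvable groups: the intersection, over all subgroups
`T` of `G`, of the normalizers in `G` of the `p`-supersolvable residual of `T`. -/
def pSupersolvableNorm (p : ℕ) (G : Type u) [Group G] : Subgroup G :=
  ⨅ T : Subgroup G,
    Subgroup.normalizer (((pSupersolvableResidual p T).map T.subtype : Subgroup G) : Set G)

/-- A finite group is `p`-nilpotent if it has a normal `p`-complement: a normal `p'`-subgroup
whose index is a power of `p`. -/
def IsPNilpotent (p : ℕ) (G : Type u) [Group G] : Prop :=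
  ∃ K : Subgroup G, K.Normal ∧ ¬ p ∣ Nat.card K ∧ ∃ k : ℕ, K.index = p ^ k

/-- The `p`-Fitting subgroup: the subgroup generated by all normal `p`-nilpotent subgroups (in a
finite group this is the largest normal `p`-nilpotent subgroup). -/
def pFitting (p : ℕ) (G : Type u) [Group G] : Subgroup G :=
  sSup {N : Subgroup G | N.Normal ∧ IsPNilpotent p N}

instance pFitting_normal (p : ℕ) (G : Type u) [Group G] : (pFitting p G).Normal :=
  Subgroup.sSup_normal _ fun _ hN => hN.1

/-- The upper `p`-Fitting series, together with the normality of its terms. -/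
def pFittingSeriesAux (p : ℕ) (G : Type u) [Group G] : ℕ → {H : Subgroup G // H.Normal}
  | 0 => ⟨⊥, inferInstance⟩
  | i + 1 =>
    let F := pFittingSeriesAux p G i
    haveI : F.1.Normal := F.2
    ⟨(pFitting p (G ⧸ F.1)).comap (QuotientGroup.mk' F.1), inferInstance⟩

/-- The upper `p`-Fitting series: the zeroth term is trivial, and the quotient of the term `i + 1`
by the term `i` is the `p`-Fitting subgroup of the quotient of `G` by the term `i`. -/
def pFittingSeries (p : ℕ) (G : Type u) [Group G] (i : ℕ) : Subgroup G :=
  (pFittingSeriesAux p G i).1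

/-- The `p`-Fitting length: the smallest positive `n` such that the `n`-th term of the upper
`p`-Fitting series is the whole group; it is `⊤` if there is no such `n` (which does not happen
for a finite `p`-solvable group). -/
noncomputable def pFittingLength (p : ℕ) (G : Type u) [Group G] : ℕ∞ :=
  ⨅ (n : ℕ) (_ : 0 < n ∧ pFittingSeries p G n = ⊤), (n : ℕ∞)

open Subgroup

/-! Part 1 is an induction on `|G|`: p-solvability and the norm condition pass to subgroups and
quotients. A nontrivial normal p-subgroup can be factored out, so let `O_p(G) = 1`. For proper `M`
the residual is a p-group by induction and normal in `G` by the norm condition, hence trivial, so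
every proper subgroup is p-supersolvable. A minimal normal subgroup is now a p'-group, and a
Frattini argument (`isPSupersolvable_of_isPGroup_residual`) shows that `G` itself is
p-supersolvable.

Part 2: the norm of `G/N` is all of `G/N`, which is nontrivial.

Part 3: the residual, a p-group, lies in `F_p^1`. The derived subgroup of a p-supersolvable group is
p-nilpotent (`IsPSupersolvable.isPNilpotent_commutator`), so `G'` lies in `F_p^2`; the abelian
quotient above it is p-nilpotent. -/

/-- Every chief factor of `G` has an order satisfying `φ`. -/
def ChiefFactorsSatisfy (φ : ℕ → Prop) (G : Type*) [Group G] : Prop :=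
  ∀ K H : Subgroup G, IsChiefFactor K H → φ (K.relIndex H)

/-! ### Transfer of chief factors along homomorphisms -/

section ChiefFactors

variable {φ : ℕ → Prop} {G M : Type*} [Group G] [Group M]

theorem Subgroup.relIndex_dvd_of_le_right_of_normal (N : Subgroup G) [N.Normal] {H K : Subgroup G}
    (h : H ≤ K) : N.relIndex H ∣ N.relIndex K := by
  rw [← relIndex_subgroupOf h]
  exact relIndex_dvd_index_of_normal _ _

theorem exists_isChiefFactor [Finite G] (N : Subgroup G) [hN : N.Normal] (h : N ≠ ⊥) :
    ∃ K : Subgroup G, IsChiefFactor K N := by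
  obtain ⟨K, ⟨hK, hKN⟩, hmax⟩ := (wellFounded_gt (α := Subgroup G)).has_min
    {K | K.Normal ∧ K < N} ⟨⊥, inferInstance, bot_lt_iff_ne_bot.2 h⟩
  refine ⟨K, hK, hN, hKN, fun L hL hKL hLN => ?_⟩
  by_contra! hc
  exact hmax L ⟨hL, lt_of_le_of_ne hLN hc.2⟩ (lt_of_le_of_ne hKL (Ne.symm hc.1))

theorem exists_isChiefFactor_bot [Finite G] [Nontrivial G] :
    ∃ N : Subgroup G, IsChiefFactor ⊥ N := by
  obtain ⟨N, ⟨hN, hN'⟩, hmin⟩ := (wellFounded_lt (α := Subgroup G)).has_min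
    {K | K.Normal ∧ K ≠ ⊥} ⟨⊤, inferInstance, top_ne_bot⟩
  refine ⟨N, inferInstance, hN, bot_lt_iff_ne_bot.2 hN', fun L hL _ hLN => ?_⟩
  by_contra! hc
  exact hmin L ⟨hL, hc.1⟩ (lt_of_le_of_ne hLN hc.2)

/-- The dichotomy: a normal subgroup of `H` of the form `H ⊓ D` either avoids or covers `H / K`. -/
theorem IsChiefFactor.le_or_le {K H D : Subgroup G} (h : IsChiefFactor K H) (hD : D.Normal) :
    H ⊓ D ≤ K ∨ H ≤ K ⊔ (H ⊓ D) := by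
  obtain ⟨hK, hH, hlt, hmax⟩ := h
  rcases hmax (K ⊔ (H ⊓ D)) inferInstance le_sup_left (sup_le hlt.le inf_le_left) with h | h
  · left; rw [← h]; exact le_sup_right
  · right; exact h.ge

theorem IsChiefFactor.relIndex_dvd {K H D : Subgroup G} (h : IsChiefFactor K H) {A : Subgroup G}
    (hD : H ≤ K ⊔ (H ⊓ D)) (hA : H ⊓ D ⊓ A ≤ K) :
    K.relIndex H ∣ A.relIndex (H ⊓ D) := by
  have := h.1
  have h1 : K ⊔ (H ⊓ D) = H := le_antisymm (sup_le h.2.2.1.le inf_le_left) hD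
  have h2 : K.relIndex H = K.relIndex (H ⊓ D) := by
    conv_lhs => rw [← h1, relIndex_sup_left]
  rw [h2, ← inf_relIndex_right A]
  exact relIndex_dvd_of_le_left _ (by rwa [inf_comm])

theorem ChiefFactorsSatisfy.of_hom [Finite G] (hφ : ∀ a b, a ∣ b → φ b → φ a)
    (hG : ChiefFactorsSatisfy φ G) (f : M →* G) {K H D : Subgroup M} (h : IsChiefFactor K H)
    (hD : D.Normal) (hHD : H ≤ K ⊔ (H ⊓ D)) (hker : H ⊓ D ⊓ f.ker ≤ K) :
    φ (K.relIndex H) := by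
  -- For `N` minimal whose preimage still covers `H / K`, and `N / N'` a chief factor, the preimage
  -- of `N'` avoids `H / K`; hence `|H / K|` divides `|N / N'|`.
  obtain ⟨N, ⟨hN, hHN⟩, hmin⟩ := (wellFounded_lt (α := Subgroup G)).has_min
    {N | N.Normal ∧ H ≤ K ⊔ (H ⊓ (D ⊓ N.comap f))} ⟨⊤, inferInstance, by simpa using hHD⟩
  have hbot : N ≠ ⊥ := by
    rintro rfl
    rw [MonoidHom.comap_bot, ← inf_assoc, sup_eq_left.2 hker] at hHN
    exact h.2.2.1.not_ge hHN
  obtain ⟨N', hN'⟩ := exists_isChiefFactor N hbot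
  have := hN'.1
  have h1 : H ⊓ (D ⊓ N'.comap f) ≤ K :=
    (h.le_or_le (D := D ⊓ N'.comap f) inferInstance).resolve_right
      fun hc => hmin N' ⟨hN'.1, hc⟩ hN'.2.2.1
  refine hφ _ _ ?_ (hG _ _ hN')
  refine (h.relIndex_dvd (A := N'.comap f) hHN ?_).trans ?_
  · refine le_trans ?_ h1
    exact le_inf (inf_le_left.trans inf_le_left)
      (le_inf (inf_le_left.trans (inf_le_right.trans inf_le_left)) inf_le_right)
  · rw [relIndex_comap]
    apply relIndex_dvd_of_le_right_of_normal
    rw [map_le_iff_le_comap]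
    exact inf_le_right.trans inf_le_right

theorem ChiefFactorsSatisfy.of_injective [Finite G] (hφ : ∀ a b, a ∣ b → φ b → φ a)
    (hG : ChiefFactorsSatisfy φ G) (f : M →* G) (hf : Function.Injective f) :
    ChiefFactorsSatisfy φ M := fun K H h =>
  hG.of_hom hφ f h (D := ⊤) inferInstance (by simp) (by simp [(f.ker_eq_bot_iff).2 hf])

theorem ChiefFactorsSatisfy.of_surjective (hG : ChiefFactorsSatisfy φ G) (f : G →* M)
    (hf : Function.Surjective f) : ChiefFactorsSatisfy φ M := by
  rintro K H ⟨hK, hH, hlt, hmax⟩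
  have h : IsChiefFactor (K.comap f) (H.comap f) := by
    refine ⟨inferInstance, inferInstance, (comap_lt_comap_of_surjective hf).2 hlt,
      fun L hL h1 h2 => ?_⟩
    have hLc : (L.map f).comap f = L := by
      rw [comap_map_eq, sup_eq_left]
      exact le_trans (fun x hx => by
        rw [mem_comap, (MonoidHom.mem_ker).1 hx]; exact K.one_mem) h1
    have h3 : K ≤ L.map f := by rwa [← comap_le_comap_of_surjective hf, hLc]
    rcases hmax (L.map f) (hL.map f hf) h3 (map_le_iff_le_comap.2 h2) with h | h
    · left; rw [← hLc, h]
    · right; rw [← hLc, h]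
  have := hG _ _ h
  rwa [relIndex_comap, map_comap_eq_self_of_surjective hf] at this

theorem ChiefFactorsSatisfy.of_hom_of_card_ker [Finite G] (hφ : ∀ a b, a ∣ b → φ b → φ a)
    (hG : ChiefFactorsSatisfy φ G) (f : M →* G) (hker : φ (Nat.card f.ker)) :
    ChiefFactorsSatisfy φ M := fun K H h => by
  rcases h.le_or_le (D := f.ker) inferInstance with h1 | h1
  · exact hG.of_hom hφ f h (D := ⊤) inferInstance (by simp) (by simpa using h1)
  · refine hφ _ _ (h.relIndex_dvd (A := ⊥) h1 (by simp)) (hφ _ _ ?_ hker)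
    rw [relIndex_bot_left]
    exact card_dvd_of_le inf_le_right

/-- A chief factor avoided by `f.ker` is compared with `M ⧸ A`; one covered by `f.ker` is compared
with `M ⧸ B`, as `g` is injective on `f.ker`. -/
theorem ChiefFactorsSatisfy.quotient_inf [Finite M] (hφ : ∀ a b, a ∣ b → φ b → φ a)
    (A B : Subgroup M) [A.Normal] [B.Normal] (hA : ChiefFactorsSatisfy φ (M ⧸ A))
    (hB : ChiefFactorsSatisfy φ (M ⧸ B)) : ChiefFactorsSatisfy φ (M ⧸ A ⊓ B) := by
  let f := QuotientGroup.map (A ⊓ B) A (MonoidHom.id M) inf_le_left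
  let g := QuotientGroup.map (A ⊓ B) B (MonoidHom.id M) inf_le_right
  have hfg : f.ker ⊓ g.ker = ⊥ := by
    rw [eq_bot_iff]
    intro x
    induction x using QuotientGroup.induction_on with
    | H x =>
      rintro ⟨h1, h2⟩
      rw [mem_bot, QuotientGroup.eq_one_iff]
      exact ⟨(QuotientGroup.eq_one_iff (N := A) x).1 h1, (QuotientGroup.eq_one_iff (N := B) x).1 h2⟩
  intro K H h
  rcases h.le_or_le (D := f.ker) inferInstance with h1 | h1
  · exact hA.of_hom hφ f h (D := ⊤) inferInstance (by simp) (by simpa using h1)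
  · exact hB.of_hom hφ g h (D := f.ker) inferInstance h1 (by simp [inf_assoc, hfg])

end ChiefFactors

/-! ### p-supersolvable groups and their residual -/

section PSupersolvable

variable {p : ℕ} {G : Type u} [Group G]

theorem eq_prime_or_not_dvd_of_dvd (hp : p.Prime) (a b : ℕ) (hab : a ∣ b)
    (hb : b = p ∨ ¬ p ∣ b) : a = p ∨ ¬ p ∣ a := by
  rcases hb with rfl | hb
  · rcases (Nat.dvd_prime hp).1 hab with rfl | rfl
    · exact Or.inr hp.not_dvd_one
    · exact Or.inl rfl
  · exact Or.inr fun h => hb (h.trans hab)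

theorem prime_pow_or_not_dvd_of_dvd (hp : p.Prime) (a b : ℕ) (hab : a ∣ b)
    (hb : (∃ k, b = p ^ k) ∨ ¬ p ∣ b) : (∃ k, a = p ^ k) ∨ ¬ p ∣ a := by
  rcases hb with ⟨k, rfl⟩ | hb
  · obtain ⟨j, -, rfl⟩ := (Nat.dvd_prime_pow hp).1 hab
    exact Or.inl ⟨j, rfl⟩
  · exact Or.inr fun h => hb (h.trans hab)

theorem IsPSolvable.subgroup [hp : Fact p.Prime] [Finite G] (h : IsPSolvable p G)
    (M : Subgroup G) : IsPSolvable p M :=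
  ChiefFactorsSatisfy.of_injective (prime_pow_or_not_dvd_of_dvd hp.out) h M.subtype
    M.subtype_injective

theorem IsPSolvable.of_surjective (h : IsPSolvable p G) {Q : Type u} [Group Q] (f : G →* Q)
    (hf : Function.Surjective f) : IsPSolvable p Q :=
  ChiefFactorsSatisfy.of_surjective (φ := fun n => (∃ k : ℕ, n = p ^ k) ∨ ¬ p ∣ n) h f hf

theorem IsPSupersolvable.of_surjective (h : IsPSupersolvable p G) {Q : Type u} [Group Q]
    (f : G →* Q) (hf : Function.Surjective f) : IsPSupersolvable p Q :=
  ChiefFactorsSatisfy.of_surjective (φ := fun n => n = p ∨ ¬ p ∣ n) h f hf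

theorem IsPSupersolvable.of_not_dvd_card_ker [hp : Fact p.Prime] {Q : Type u} [Group Q] [Finite Q]
    (h : IsPSupersolvable p Q) (f : G →* Q) (hf : ¬ p ∣ Nat.card f.ker) : IsPSupersolvable p G :=
  ChiefFactorsSatisfy.of_hom_of_card_ker (eq_prime_or_not_dvd_of_dvd hp.out) h f (Or.inr hf)

theorem isPSupersolvable_of_not_dvd_card [Finite G] (h : ¬ p ∣ Nat.card G) :
    IsPSupersolvable p G := fun K H _ =>
  Or.inr fun hd => h (hd.trans ((relIndex_dvd_card K H).trans H.card_subgroup_dvd_card))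

instance pSupersolvableResidual_normal : (pSupersolvableResidual p G).Normal :=
  ⟨fun n hn g => by
    rw [pSupersolvableResidual, mem_sInf] at hn ⊢
    exact fun N hN => hN.1.conj_mem n (hn N hN) g⟩

theorem pSupersolvableResidual_le {N : Subgroup G} [hN : N.Normal]
    (h : IsPSupersolvable p (G ⧸ N)) : pSupersolvableResidual p G ≤ N :=
  sInf_le ⟨hN, h⟩

theorem isPSupersolvable_quotient_residual [hp : Fact p.Prime] [Finite G] :
    IsPSupersolvable p (G ⧸ pSupersolvableResidual p G) := by
  let S := {N : Subgroup G | ∃ _ : N.Normal, IsPSupersolvable p (G ⧸ N)}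
  -- `S` is closed under intersection, so a minimal member is its least member, the residual.
  obtain ⟨N, hN, hmin⟩ := (wellFounded_lt (α := Subgroup G)).has_min S
    ⟨⊤, inferInstance, isPSupersolvable_of_not_dvd_card (by
      rw [← index_eq_card, index_top]; exact hp.out.not_dvd_one)⟩
  have hmem : pSupersolvableResidual p G ∈ S := by
    convert hN
    refine le_antisymm (sInf_le hN) (le_sInf fun L hL => ?_)
    obtain ⟨hN1, hN2⟩ := hN
    obtain ⟨hL1, hL2⟩ := hL
    have h : N ⊓ L ∈ S := ⟨inferInstance, ChiefFactorsSatisfy.quotient_inf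
      (eq_prime_or_not_dvd_of_dvd hp.out) N L hN2 hL2⟩
    by_contra hc
    exact hmin _ h (inf_lt_left.2 hc)
  exact hmem.2

theorem pSupersolvableResidual_eq_bot_iff [Fact p.Prime] [Finite G] :
    pSupersolvableResidual p G = ⊥ ↔ IsPSupersolvable p G := by
  constructor
  · intro h
    have := isPSupersolvable_quotient_residual (p := p) (G := G)
    let e := (QuotientGroup.quotientMulEquivOfEq h).trans QuotientGroup.quotientBot
    exact this.of_surjective e.toMonoidHom e.surjective
  · intro h
    rw [eq_bot_iff]
    exact pSupersolvableResidual_le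
      (h.of_surjective _ (QuotientGroup.mk'_surjective _))

theorem map_pSupersolvableResidual [Fact p.Prime] [Finite G] {Q : Type u} [Group Q] (f : G →* Q)
    (hf : Function.Surjective f) :
    (pSupersolvableResidual p G).map f = pSupersolvableResidual p Q := by
  have : Finite Q := Finite.of_surjective f hf
  apply le_antisymm
  · rw [map_le_iff_le_comap]
    apply pSupersolvableResidual_le
    let e := QuotientGroup.quotientKerEquivOfSurjective
      ((QuotientGroup.mk' (pSupersolvableResidual p Q)).comp f)
      ((QuotientGroup.mk'_surjective _).comp hf)
    let e' := (QuotientGroup.quotientMulEquivOfEq (show (pSupersolvableResidual p Q).comap f =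
      ((QuotientGroup.mk' (pSupersolvableResidual p Q)).comp f).ker by
        rw [← MonoidHom.comap_ker, QuotientGroup.ker_mk'])).trans e
    exact isPSupersolvable_quotient_residual.of_surjective e'.symm.toMonoidHom e'.symm.surjective
  · have : ((pSupersolvableResidual p G).map f).Normal := Normal.map inferInstance f hf
    apply pSupersolvableResidual_le
    exact isPSupersolvable_quotient_residual.of_surjective
      (QuotientGroup.map (pSupersolvableResidual p G) _ f (le_comap_map _ _))
      (QuotientGroup.map_surjective_of_surjective _ _ _
        ((QuotientGroup.mk'_surjective _).comp hf) _)

end PSupersolvable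

/-! ### p-nilpotency and the derived subgroup -/

section PNilpotent

variable {p : ℕ} {G E : Type u} [Group G] [Group E]

theorem IsPNilpotent.of_surjective [hp : Fact p.Prime] [Finite G] (h : IsPNilpotent p G)
    (f : G →* E) (hf : Function.Surjective f) : IsPNilpotent p E := by
  obtain ⟨K, hK, hcard, k, hk⟩ := h
  refine ⟨K.map f, hK.map f hf, fun hd => hcard (hd.trans (card_map_dvd K f)), ?_⟩
  obtain ⟨j, -, hj⟩ := (Nat.dvd_prime_pow hp.out).1 (hk ▸ K.index_map_dvd hf)
  exact ⟨j, hj⟩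

theorem IsPGroup.isPNilpotent [hp : Fact p.Prime] [Finite G] (h : IsPGroup p G) :
    IsPNilpotent p G := by
  obtain ⟨n, hn⟩ := IsPGroup.iff_card.1 h
  exact ⟨⊥, inferInstance, by simpa using hp.out.ne_one, n, by rw [index_bot, hn]⟩

theorem IsPNilpotent.of_not_dvd_card_ker [hp : Fact p.Prime] (h : IsPNilpotent p E)
    (f : G →* E) (hf : Function.Surjective f) (hker : ¬ p ∣ Nat.card f.ker) :
    IsPNilpotent p G := by
  obtain ⟨K, hK, hcard, k, hk⟩ := h
  refine ⟨K.comap f, inferInstance, ?_, k, by rw [index_comap_of_surjective _ hf, hk]⟩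
  have h1 : Nat.card (K.comap f) = Nat.card f.ker * Nat.card K := by
    have h2 := relIndex_mul_relIndex (⊥ : Subgroup G) f.ker (K.comap f) bot_le
      ((f.comap_bot).symm ▸ comap_mono bot_le)
    rw [relIndex_bot_left, relIndex_bot_left, relIndex_ker,
      map_comap_eq_self_of_surjective hf] at h2
    exact h2.symm
  rw [h1, hp.out.dvd_mul]
  tauto

/-- A central subgroup of coprime order and index has a normal complement. -/
theorem exists_normal_isComplement'_of_le_center [Finite G] (Z : Subgroup G) [Z.Normal]
    (hZ : Z ≤ center G) (hcop : (Nat.card Z).Coprime Z.index) :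
    ∃ Q : Subgroup G, Q.Normal ∧ Z.IsComplement' Q := by
  obtain ⟨Q, hQ⟩ := exists_right_complement'_of_coprime hcop
  refine ⟨Q, normalizer_eq_top_iff.1 (top_le_iff.1 ?_), hQ⟩
  rw [← hQ.sup_eq_top]
  exact sup_le (hZ.trans (center_le_normalizer _)) le_normalizer

theorem Subgroup.Normal.mem_iff_pow_card_eq_one [Finite G] {Q : Subgroup G} (hQ : Q.Normal)
    (hcop : (Nat.card Q).Coprime Q.index) (x : G) : x ∈ Q ↔ x ^ Nat.card Q = 1 := by
  constructor
  · intro hx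
    exact congrArg Subtype.val (pow_card_eq_one' (x := (⟨x, hx⟩ : Q)))
  · intro hx
    rw [← QuotientGroup.eq_one_iff, ← orderOf_eq_one_iff, ← Nat.dvd_one, ← hcop.gcd_eq_one]
    refine Nat.dvd_gcd (orderOf_dvd_of_pow_eq_one ?_) ?_
    · rw [← QuotientGroup.mk_pow, hx, QuotientGroup.mk_one]
    · rw [index_eq_card]
      exact _root_.orderOf_dvd_natCard _

theorem Subgroup.Normal.characteristic_of_coprime [Finite G] {Q : Subgroup G} (hQ : Q.Normal)
    (hcop : (Nat.card Q).Coprime Q.index) : Q.Characteristic := by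
  rw [characteristic_iff_comap_le]
  intro φ x hx
  rw [mem_comap, hQ.mem_iff_pow_card_eq_one hcop] at hx
  rw [hQ.mem_iff_pow_card_eq_one hcop]
  apply φ.injective
  simpa using hx

/-- In the preimage `M` of the p-complement of `E`, the kernel is central with coprime index, so it
has a normal complement `Q`. As a normal Hall subgroup, `Q` is characteristic in `M`, hence normal
in `G`. -/
theorem IsPNilpotent.of_ker_le_center [hp : Fact p.Prime] [Finite G] (h : IsPNilpotent p E)
    (f : G →* E) (hf : Function.Surjective f) (hker : IsPGroup p f.ker)
    (hZ : f.ker ≤ center G) : IsPNilpotent p G := by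
  obtain ⟨K, hK, hcard, k, hk⟩ := h
  let M := K.comap f
  have hZM : f.ker ≤ M := (f.comap_bot).symm ▸ comap_mono bot_le
  let Z := f.ker.subgroupOf M
  obtain ⟨n, hn⟩ := IsPGroup.iff_card.1 hker
  have hZcard : Nat.card Z = p ^ n := by
    rw [← hn]; exact Nat.card_congr (subgroupOfEquivOfLe hZM).toEquiv
  have hZindex : Z.index = Nat.card K := by
    change f.ker.relIndex M = _
    rw [relIndex_ker, map_comap_eq_self_of_surjective hf]
  have hcop : (p ^ n).Coprime (Nat.card K) :=
    Nat.Coprime.pow_left _ ((Nat.Prime.coprime_iff_not_dvd hp.out).2 hcard)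
  obtain ⟨Q, hQ, hQZ⟩ := exists_normal_isComplement'_of_le_center Z
    (fun x hx => mem_center_iff.2 fun y => Subtype.ext (mem_center_iff.1 (hZ hx) y))
    (by rwa [hZcard, hZindex])
  have hQcard : Nat.card Q = Nat.card K := by rw [← hZindex, hQZ.symm.index_eq_card]
  have hQindex : Q.index = p ^ n := by rw [hQZ.index_eq_card, hZcard]
  have : Q.Characteristic := hQ.characteristic_of_coprime (by rw [hQcard, hQindex]; exact hcop.symm)
  refine ⟨Q.map M.subtype, inferInstance, ?_, n + k, ?_⟩
  · rwa [card_map_of_injective M.subtype_injective, hQcard]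
  · rw [index_map_subtype, hQindex, index_comap_of_surjective _ hf, hk, pow_add]

theorem IsMulCommutative.isPNilpotent [hp : Fact p.Prime] [Finite G] (h : IsMulCommutative G) :
    IsPNilpotent p G := by
  let P : Sylow p G := default
  have hcomm : ∀ H : Subgroup G, H.Normal := fun H => ⟨fun n hn g => by
    rwa [h.is_comm.comm g n, mul_inv_cancel_right]⟩
  have := hcomm P
  obtain ⟨n, hn⟩ := IsPGroup.iff_card.1 P.2
  have hcop := P.card_coprime_index
  obtain ⟨Q, hQ⟩ := exists_right_complement'_of_coprime hcop
  refine ⟨Q, hcomm Q, ?_, n, by rw [hQ.index_eq_card]; exact hn⟩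
  rw [← hQ.symm.index_eq_card]
  exact P.not_dvd_index

/-- Automorphisms of a cyclic group are power maps, so they commute and conjugation by a commutator
is trivial on `N`. -/
theorem commutator_le_centralizer_of_isCyclic (N : Subgroup G) [N.Normal] [IsCyclic N] :
    commutator G ≤ centralizer N := by
  have hker : commutator G ≤ (MulAut.conjNormal (H := N)).ker := by
    rw [_root_.commutator_def, commutator_le]
    intro a _ b _
    rw [MonoidHom.mem_ker, map_commutatorElement, commutatorElement_eq_one_iff_mul_comm]
    obtain ⟨m, hm⟩ := (MulAut.conjNormal (H := N) a).toMonoidHom.map_cyclic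
    obtain ⟨n, hn⟩ := (MulAut.conjNormal (H := N) b).toMonoidHom.map_cyclic
    ext x
    congr 1
    exact ((hm _).trans (congrArg (· ^ m) (hn x))).trans
      (((zpow_comm _ _ _).trans (congrArg (· ^ n) (hm x)).symm).trans (hn _).symm)
  intro g hg
  rw [mem_centralizer_iff]
  intro x hx
  have h1 := congrArg Subtype.val (DFunLike.congr_fun (MonoidHom.mem_ker.1 (hker hg)) ⟨x, hx⟩)
  rw [MulAut.conjNormal_apply] at h1
  exact (mul_inv_eq_iff_eq_mul.1 h1).symm

theorem map_mk'_commutator (N : Subgroup G) [N.Normal] :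
    (commutator G).map (QuotientGroup.mk' N) = commutator (G ⧸ N) := by
  rw [_root_.commutator_def, map_commutator,
    map_top_of_surjective _ (QuotientGroup.mk'_surjective N), _root_.commutator_def]

theorem Subgroup.card_quotient_lt [Finite G] {N : Subgroup G} (hN : N ≠ ⊥) :
    Nat.card (G ⧸ N) < Nat.card G := by
  rw [← card_mul_index N, index_eq_card]
  exact lt_mul_left Nat.card_pos ((one_lt_card_iff_ne_bot N).2 hN)

/-- Induction through a minimal normal subgroup `N`: if `|N| = p`, then `N` is cyclic and `G'`
centralizes it; otherwise `N` is a p'-group. In both cases p-nilpotency lifts from `(G/N)'`. -/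
theorem IsPSupersolvable.isPNilpotent_commutator [hp : Fact p.Prime] [Finite G]
    (h : IsPSupersolvable p G) : IsPNilpotent p (commutator G) := by
  induction hn : Nat.card G using Nat.strong_induction_on generalizing G with
  | _ n ih =>
  subst hn
  rcases subsingleton_or_nontrivial G with hG | hG
  · exact IsPGroup.isPNilpotent (IsPGroup.of_subsingleton _ _)
  obtain ⟨N, hN⟩ := exists_isChiefFactor_bot (G := G)
  have := hN.2.1
  have hQ := ih _ (card_quotient_lt hN.2.2.1.ne') (h.of_surjective _ (QuotientGroup.mk'_surjective N)) rfl
  let π := QuotientGroup.mk' N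
  rw [← map_mk'_commutator] at hQ
  let f := π.subgroupMap (commutator G)
  have hf : Function.Surjective f := π.subgroupMap_surjective _
  have hker : ∀ x : commutator G, x ∈ f.ker ↔ (x : G) ∈ N := fun x => by
    rw [MonoidHom.mem_ker, ← QuotientGroup.eq_one_iff, ← Subtype.coe_inj]
    rfl
  have hker' : f.ker = N.subgroupOf (commutator G) := by
    ext x; rw [hker, mem_subgroupOf]
  have hcard : Nat.card f.ker ∣ Nat.card N := by
    rw [hker']
    exact card_comap_dvd_of_injective _ _ (subtype_injective _)
  have hchief := h _ _ hN
  rw [relIndex_bot_left] at hchief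
  rcases hchief with hNp | hNp
  · have := isCyclic_of_prime_card hNp
    refine hQ.of_ker_le_center f hf (IsPGroup.of_card_dvd_pow (n := 1) (by simpa [hNp] using hcard))
      fun x hx => mem_center_iff.2 fun y => Subtype.ext ?_
    exact (mem_centralizer_iff.1 (commutator_le_centralizer_of_isCyclic N y.2) x
      ((hker x).1 hx)).symm
  · exact hQ.of_not_dvd_card_ker f hf fun hd => hNp (hd.trans hcard)

end PNilpotent

/-! ### The norm condition and the residual as a p-group -/

section Norm

variable {p : ℕ} {G : Type u} [Group G]

theorem pSupersolvableNorm_eq_top_iff : pSupersolvableNorm p G = ⊤ ↔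
    ∀ T : Subgroup G, ((pSupersolvableResidual p T).map T.subtype).Normal := by
  simp only [pSupersolvableNorm, iInf_eq_top, normalizer_eq_top_iff]

theorem map_pSupersolvableResidual_map [Fact p.Prime] [Finite G] {Q : Type u} [Group Q]
    (f : G →* Q) (T : Subgroup G) :
    (pSupersolvableResidual p (T.map f)).map (T.map f).subtype =
      ((pSupersolvableResidual p T).map T.subtype).map f := by
  rw [← map_pSupersolvableResidual (f.subgroupMap T) (f.subgroupMap_surjective T), map_map,
    map_map]
  rfl

theorem pSupersolvableNorm_eq_top_of_surjective [Fact p.Prime] [Finite G]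
    (h : pSupersolvableNorm p G = ⊤) {Q : Type u} [Group Q] (f : G →* Q)
    (hf : Function.Surjective f) : pSupersolvableNorm p Q = ⊤ := by
  rw [pSupersolvableNorm_eq_top_iff] at h ⊢
  intro T
  have hT : (T.comap f).map f = T := map_comap_eq_self_of_surjective hf T
  rw [← hT, map_pSupersolvableResidual_map]
  exact (h _).map f hf

theorem pSupersolvableNorm_eq_top_subgroup [Fact p.Prime] [Finite G]
    (h : pSupersolvableNorm p G = ⊤) (M : Subgroup G) : pSupersolvableNorm p M = ⊤ := by
  rw [pSupersolvableNorm_eq_top_iff] at h ⊢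
  intro T
  have h1 := h (T.map M.subtype)
  rw [map_pSupersolvableResidual_map] at h1
  rw [← comap_map_eq_self_of_injective M.subtype_injective
    ((pSupersolvableResidual p T).map T.subtype)]
  exact h1.comap _

theorem Subgroup.isPGroup_of_map_isPGroup {P R : Subgroup G} [P.Normal] (hP : IsPGroup p P)
    (h : IsPGroup p (R.map (QuotientGroup.mk' P))) : IsPGroup p R :=
  (h.comap_of_ker_isPGroup (QuotientGroup.mk' P) (by rwa [QuotientGroup.ker_mk'])).to_le
    (le_comap_map _ _)

theorem isPSupersolvable_of_isPGroup_residual [hp : Fact p.Prime] [Finite G] {Q : Type u} [Group Q]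
    (f : G →* Q) (hf : Function.Surjective f) (hker : ¬ p ∣ Nat.card f.ker)
    (hO : ∀ P : Subgroup G, P.Normal → IsPGroup p P → P = ⊥)
    (hM : ∀ M : Subgroup G, M ≠ ⊤ → IsPSupersolvable p M)
    (hQ : IsPGroup p (pSupersolvableResidual p Q)) : IsPSupersolvable p G := by
  have : Finite Q := Finite.of_surjective f hf
  refine IsPSupersolvable.of_not_dvd_card_ker ?_ f hker
  let R := (pSupersolvableResidual p Q).comap f
  let g : R →* pSupersolvableResidual p Q := f.subgroupComap _
  have hg : Function.Surjective g := f.subgroupComap_surjective_of_surjective _ hf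
  let S : Sylow p R := default
  -- The image of a Sylow p-subgroup of `R` is Sylow in a p-group, so it is everything.
  have hS : S.1.map g = ⊤ := by
    have h1 := (S.mapSurjective hg).3 (hQ.to_subgroup ⊤) le_top
    exact h1.symm
  have hSR : (S.1.map R.subtype).map f = R.map f := by
    rw [map_comap_eq_self_of_surjective hf, map_map]
    change S.1.map ((pSupersolvableResidual p Q).subtype.comp g) = _
    rw [← map_map, hS, ← MonoidHom.range_eq_map, range_subtype]
  have hfr := S.normalizer_sup_eq_top
  set L := normalizer ((S.1.map R.subtype : Subgroup G) : Set G) with hL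
  by_cases hLtop : L = ⊤
  · have h1 : S.1.map R.subtype = ⊥ :=
      hO _ (normalizer_eq_top_iff.1 hLtop) (S.2.map _)
    rw [h1, Subgroup.map_bot, map_comap_eq_self_of_surjective hf] at hSR
    exact pSupersolvableResidual_eq_bot_iff.1 hSR.symm
  -- By Frattini `G = L R`, and `f(R) = f(S)` lies in `f(L)`; so the proper, p-supersolvable
  -- subgroup `L` maps onto `Q`.
  · refine (hM L hLtop).of_surjective (f.comp L.subtype) ?_
    rw [← MonoidHom.range_eq_top, MonoidHom.range_eq_map, ← map_map, ← MonoidHom.range_eq_map,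
      range_subtype]
    have h2 : R.map f ≤ L.map f := hSR ▸ map_mono le_normalizer
    have h3 := congrArg (map f) hfr
    rwa [Subgroup.map_sup, map_top_of_surjective _ hf, sup_eq_left.2 h2] at h3

theorem IsPSolvable.isPGroup_residual [hp : Fact p.Prime] [Finite G] (hsolv : IsPSolvable p G)
    (hnorm : pSupersolvableNorm p G = ⊤) : IsPGroup p (pSupersolvableResidual p G) := by
  induction hn : Nat.card G using Nat.strong_induction_on generalizing G with
  | _ n ih =>
  subst hn
  have hquot : ∀ N : Subgroup G, [N.Normal] → N ≠ ⊥ →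
      IsPGroup p (pSupersolvableResidual p (G ⧸ N)) := fun N _ hN =>
    ih _ (card_quotient_lt hN) (hsolv.of_surjective _ (QuotientGroup.mk'_surjective N))
      (pSupersolvableNorm_eq_top_of_surjective hnorm _ (QuotientGroup.mk'_surjective N)) rfl
  by_cases hO : ∀ P : Subgroup G, P.Normal → IsPGroup p P → P = ⊥
  swap
  · push Not at hO
    obtain ⟨P, hPn, hP, hPbot⟩ := hO
    have h1 := hquot P hPbot
    rw [← map_pSupersolvableResidual _ (QuotientGroup.mk'_surjective P)] at h1
    exact isPGroup_of_map_isPGroup hP h1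
  rcases subsingleton_or_nontrivial G with hG | hG
  · exact IsPGroup.of_subsingleton _ _
  have hM : ∀ M : Subgroup G, M ≠ ⊤ → IsPSupersolvable p M := fun M hM => by
    have hlt : Nat.card M < Nat.card G :=
      lt_of_le_of_ne (card_le_card_group M) fun h => hM (card_eq_iff_eq_top M |>.1 h)
    have h1 := ih _ hlt (hsolv.subgroup M) (pSupersolvableNorm_eq_top_subgroup hnorm M) rfl
    have h2 := hO _ (pSupersolvableNorm_eq_top_iff.1 hnorm M) (h1.map _)
    rwa [map_eq_bot_iff_of_injective _ M.subtype_injective,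
      pSupersolvableResidual_eq_bot_iff] at h2
  obtain ⟨N, hN⟩ := exists_isChiefFactor_bot (G := G)
  have hNn := hN.2.1
  have hNbot := hN.2.2.1.ne'
  have hNp : ¬ p ∣ Nat.card N := by
    have h1 := hsolv _ _ hN
    rw [relIndex_bot_left] at h1
    exact h1.resolve_left fun ⟨k, hk⟩ => hNbot (hO N hNn (IsPGroup.of_card hk))
  have := isPSupersolvable_of_isPGroup_residual (QuotientGroup.mk' N)
    (QuotientGroup.mk'_surjective N) (by rwa [QuotientGroup.ker_mk']) hO hM (hquot N hNbot)
  rw [pSupersolvableResidual_eq_bot_iff.2 this]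
  exact IsPGroup.of_bot

end Norm

/-! ### Bounding the p-Fitting length -/

section FittingLength

variable {p : ℕ} {G : Type u} [Group G]

theorem le_pFitting {N : Subgroup G} (hN : N.Normal) (h : IsPNilpotent p N) : N ≤ pFitting p G :=
  le_sSup ⟨hN, h⟩

instance pFittingSeries_normal (p : ℕ) (i : ℕ) : (pFittingSeries p G i).Normal :=
  (pFittingSeriesAux p G i).2

theorem pFittingSeries_succ (p : ℕ) (i : ℕ) : pFittingSeries p G (i + 1) =
    (pFitting p (G ⧸ pFittingSeries p G i)).comap (QuotientGroup.mk' (pFittingSeries p G i)) :=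
  rfl

theorem le_pFittingSeries_succ {p i : ℕ} {N : Subgroup G} (hN : N.Normal)
    (h : IsPNilpotent p (N.map (QuotientGroup.mk' (pFittingSeries p G i)))) :
    N ≤ pFittingSeries p G (i + 1) := by
  rw [pFittingSeries_succ, ← map_le_iff_le_comap]
  exact le_pFitting (hN.map _ (QuotientGroup.mk'_surjective _)) h

theorem pFittingSeries_three_eq_top [hp : Fact p.Prime] [Finite G]
    (h : IsPGroup p (pSupersolvableResidual p G)) : pFittingSeries p G 3 = ⊤ := by
  have h1 : pSupersolvableResidual p G ≤ pFittingSeries p G 1 :=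
    le_pFittingSeries_succ inferInstance (h.map _).isPNilpotent
  have h2 : commutator G ≤ pFittingSeries p G 2 := by
    refine le_pFittingSeries_succ inferInstance ?_
    rw [map_mk'_commutator]
    refine IsPSupersolvable.isPNilpotent_commutator ?_
    exact isPSupersolvable_quotient_residual.of_surjective
      (QuotientGroup.map _ (pFittingSeries p G 1) (MonoidHom.id G) h1)
      (QuotientGroup.map_surjective_of_surjective _ _ _ QuotientGroup.mk_surjective _)
  refine top_le_iff.1 (le_pFittingSeries_succ inferInstance ?_)
  have h3 : IsMulCommutative (G ⧸ pFittingSeries p G 2) := by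
    rw [← commutator_eq_bot_iff, ← map_mk'_commutator, Subgroup.map_eq_bot_iff, QuotientGroup.ker_mk']
    exact h2
  exact IsMulCommutative.isPNilpotent inferInstance

theorem pFittingLength_le_three [Fact p.Prime] [Finite G]
    (h : IsPGroup p (pSupersolvableResidual p G)) : pFittingLength p G ≤ 3 :=
  iInf₂_le 3 ⟨by norm_num, pFittingSeries_three_eq_top h⟩

end FittingLength

theorem theorem4p10 (p : ℕ) [Fact p.Prime] (G : Type*) [Group G] [Finite G]
    (hsolv : IsPSolvable p G) (hnorm : pSupersolvableNorm p G = ⊤) :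
    IsPGroup p (pSupersolvableResidual p G) ∧
    (∀ (N : Subgroup G) [N.Normal], N ≠ ⊤ → pSupersolvableNorm p (G ⧸ N) ≠ ⊥) ∧
    pFittingLength p G ≤ 3 := by
  have h1 := hsolv.isPGroup_residual hnorm
  refine ⟨h1, fun N _ hN => ?_, pFittingLength_le_three h1⟩
  rw [pSupersolvableNorm_eq_top_of_surjective hnorm _ (QuotientGroup.mk'_surjective N)]
  have : Nontrivial (G ⧸ N) := QuotientGroup.nontrivial_iff.2 hN
  exact top_ne_bot
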